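/- \textbf{Theorem (Differentiation).} Let $(H,G,t,\Phi)$ be a crossed module of Lie groups: $H,G$ are (real, smooth) Lie groups, $t:H\to G$ is a Lie group homomorphism, $\Phi:G\to\mathrm{Aut}(H)$ is a smooth action of $G$ on $H$ by automorphisms, and $$\Phi(t(p))q=pqp^{-1},\qquad t(\Phi(a)p)=a\,t(p)\,a^{-1}\qquad(p,q\in H,\ a\in G).$$ Let $(\mathcal B_1,\mathcal B_0)$ be a Rota-Baxter operator on $(H,G,t,\Phi)$, i.e. $\mathcal B_1:H\to H$ and $\mathcal B_0:G\to G$ are smooth maps such that (i) $\mathcal B(a)\mathcal B(b)=\mathcal B\big(a\,\mathcal B(a)\,b\,\mathcal B(a)^{-1}\big)$ for all $a,b$, both for $\mathcal B=\mathcal B_1$ on $H$ and for $\mathcal B=\mathcal B_0$ on $G$; (ii) $t\circ\mathcal B_1=\mathcal B_0\circ t$; (iii) $\Phi(\mathcal B_0(a))\mathcal B_1(p)=\mathcal B_1\Big(\Phi(a\,\mathcal B_0(a))\big(p\,\mathcal B_1(p)\big)\cdot\Phi(\mathcal B_0(a))\big(\mathcal B_1(p)^{-1}\big)\Big)$ for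 all $a\in G$, $p\in H$. Let $\mathfrak h,\mathfrak g$ be the Lie algebras of $H,G$, let $\mathrm dt:\mathfrak h\to\mathfrak g$ be the tangent map of $t$ at the identity, and for $x\in\mathfrak g$, $u\in\mathfrak h$ let $\phi(x)u\in\mathfrak h$ be the derivative at $a=e_G$ in the direction $x$ of the map $G\to\mathfrak h$, $a\mapsto (\Phi(a))_{*e_H}u$. Put $B_1=(\mathcal B_1)_{*e_H}:\mathfrak h\to\mathfrak h$ and $B_0=(\mathcal B_0)_{*e_G}:\mathfrak g\to\mathfrak g$. Then $(\mathfrak h,\mathfrak g,\mathrm dt,\phi)$ is a crossed module of Lie algebras, i.e. $\mathrm dt$ is a Lie algebra homomorphism, $\phi:\mathfrak g\to\mathrm{Der}(\mathfrak h)$ is a Lie algebra homomorphism, and $\mathrm dt(\phi(x)u)=[x,\mathrm dt(u)]$, $\phi(\mathrm dt(u))v=[u,v]$ for all $x\in\mathfrak g$, $u,v\in\mathfrak h$; and $(B_1,B_0)$ is a Rota-Baxter operator (of weight $1$) on it, i.e. (i) $[B(x),B(y)]=B\big([B(x),y]+[x,B(y)]+[x,y]\big)$ for all $x,y$, both for $B=B_1$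 on $\mathfrak h$ and for $B=B_0$ on $\mathfrak g$; (ii) $\mathrm dt\circ B_1=B_0\circ \mathrm dt$; (iii) $\phi(B_0(x))B_1(u)=B_1\big(\phi(x)B_1(u)+\phi(B_0(x))u+\phi(x)u\big)$ for all $x\in\mathfrak g$, $u\in\mathfrak h$. -/

import Mathlib

open scoped Manifold ContDiff

/-- A smooth Lie group is in particular regular enough for Mathlib's Lie algebra structure on its
tangent space at the identity. -/
instance instLieGroupMinSmoothnessThree {E : Type*} [NormedAddCommGroup E] [NormedSpace ℝ E]
    {G : Type*} [TopologicalSpace G] [ChartedSpace E G] [Group G] [LieGroup 𝓘(ℝ, E) ∞ G] :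
    LieGroup 𝓘(ℝ, E) (minSmoothness ℝ 3) G :=
  LieGroup.of_le (n := ∞) (by rw [minSmoothness_of_isRCLikeNormedField]; exact ENat.LEInfty.out)

/-! ### Lie algebras -/

/-- A crossed module of real Lie algebras `(𝔥, 𝔤, t, φ)`. -/
structure LieAlgCrossedModule (𝔥 𝔤 : Type*) [LieRing 𝔥] [LieAlgebra ℝ 𝔥]
    [LieRing 𝔤] [LieAlgebra ℝ 𝔤] where
  /-- The Lie algebra homomorphism `𝔥 → 𝔤`. -/
  t : 𝔥 →ₗ⁅ℝ⁆ 𝔤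
  /-- The action of `𝔤` on `𝔥` by derivations. -/
  φ : 𝔤 →ₗ⁅ℝ⁆ LieDerivation ℝ 𝔥 𝔥
  map_act : ∀ (x : 𝔤) (u : 𝔥), t (φ x u) = ⁅x, t u⁆
  act_map : ∀ u v : 𝔥, φ (t u) v = ⁅u, v⁆

/-- Rota-Baxter operators of weight `1` on a real Lie algebra. -/
def IsLieAlgRotaBaxter {𝔤 : Type*} [LieRing 𝔤] [LieAlgebra ℝ 𝔤] (B : 𝔤 →ₗ[ℝ] 𝔤) : Prop :=
  ∀ x y : 𝔤, ⁅B x, B y⁆ = B (⁅B x, y⁆ + ⁅x, B y⁆ + ⁅x, y⁆)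

/-- Rota-Baxter operators (of weight `1`) on a crossed module of Lie algebras. -/
structure LieAlgCrossedModule.IsRotaBaxter {𝔥 𝔤 : Type*} [LieRing 𝔥] [LieAlgebra ℝ 𝔥]
    [LieRing 𝔤] [LieAlgebra ℝ 𝔤] (C : LieAlgCrossedModule 𝔥 𝔤)
    (B₁ : 𝔥 →ₗ[ℝ] 𝔥) (B₀ : 𝔤 →ₗ[ℝ] 𝔤) : Prop where
  rotaBaxter₁ : IsLieAlgRotaBaxter B₁
  rotaBaxter₀ : IsLieAlgRotaBaxter B₀
  map_comm : ∀ u : 𝔥, C.t (B₁ u) = B₀ (C.t u)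
  act_comm : ∀ (x : 𝔤) (u : 𝔥),
    C.φ (B₀ x) (B₁ u) = B₁ (C.φ x (B₁ u) + C.φ (B₀ x) u + C.φ x u)

/-! ### Lie groups -/

/-- A crossed module of (smooth, real) Lie groups `(H, G, t, Φ)`. The action `Φ` of `G` on `H` by
automorphisms is smooth as a map `G × H → H`. -/
structure LieGroupCrossedModule (E F : Type*) [NormedAddCommGroup E] [NormedSpace ℝ E]
    [NormedAddCommGroup F] [NormedSpace ℝ F]
    (H : Type*) [TopologicalSpace H] [ChartedSpace E H] [Group H] [LieGroup 𝓘(ℝ, E) ∞ H]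
    (G : Type*) [TopologicalSpace G] [ChartedSpace F G] [Group G] [LieGroup 𝓘(ℝ, F) ∞ G] where
  /-- The Lie group homomorphism `H → G`. -/
  t : H →* G
  contMDiff_t : ContMDiff 𝓘(ℝ, E) 𝓘(ℝ, F) ∞ t
  /-- The action of `G` on `H` by automorphisms. -/
  Φ : G →* MulAut H
  contMDiff_Φ : ContMDiff (𝓘(ℝ, F).prod 𝓘(ℝ, E)) 𝓘(ℝ, E) ∞ (fun z : G × H => Φ z.1 z.2)
  act_map : ∀ p q : H, Φ (t p) q = p * q * p⁻¹
  map_act : ∀ (a : G) (p : H), t (Φ a p) = a * t p * a⁻¹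

/-- Rota-Baxter operators on a Lie group: smooth maps `B` with
`B(a) B(b) = B(a B(a) b B(a)⁻¹)`. -/
structure IsLieGroupRotaBaxter (E : Type*) [NormedAddCommGroup E] [NormedSpace ℝ E]
    {G : Type*} [TopologicalSpace G] [ChartedSpace E G] [Group G] [LieGroup 𝓘(ℝ, E) ∞ G]
    (B : G → G) : Prop where
  contMDiff : ContMDiff 𝓘(ℝ, E) 𝓘(ℝ, E) ∞ B
  mul_eq : ∀ a b : G, B a * B b = B (a * B a * b * (B a)⁻¹)

/-- The tangent map at the identity of a map `f` between Lie groups with `f 1 = 1`, as a map between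
the Lie algebras. (In Mathlib the target of `mfderiv` at `1` is the tangent space at `f 1`; it is the
tangent space at `1` because `f 1 = 1`, which holds for homomorphisms and Rota-Baxter operators.) -/
noncomputable def tangentAtOne (E F : Type*) [NormedAddCommGroup E] [NormedSpace ℝ E]
    [NormedAddCommGroup F] [NormedSpace ℝ F]
    {H : Type*} [TopologicalSpace H] [ChartedSpace E H] [Group H]
    {G : Type*} [TopologicalSpace G] [ChartedSpace F G] [Group G] (f : H → G) :
    GroupLieAlgebra 𝓘(ℝ, E) H →L[ℝ] GroupLieAlgebra 𝓘(ℝ, F) G :=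
  mfderiv 𝓘(ℝ, E) 𝓘(ℝ, F) f 1

namespace LieGroupCrossedModule

variable {E F : Type*} [NormedAddCommGroup E] [NormedSpace ℝ E]
  [NormedAddCommGroup F] [NormedSpace ℝ F]
  {H : Type*} [TopologicalSpace H] [ChartedSpace E H] [Group H] [LieGroup 𝓘(ℝ, E) ∞ H]
  {G : Type*} [TopologicalSpace G] [ChartedSpace F G] [Group G] [LieGroup 𝓘(ℝ, F) ∞ G]

/-- Rota-Baxter operators on a crossed module of Lie groups. -/
structure IsRotaBaxter (X : LieGroupCrossedModule E F H G) (B₁ : H → H) (B₀ : G → G) : Prop where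
  rotaBaxter₁ : IsLieGroupRotaBaxter E B₁
  rotaBaxter₀ : IsLieGroupRotaBaxter F B₀
  map_comm : ∀ p : H, X.t (B₁ p) = B₀ (X.t p)
  act_comm : ∀ (a : G) (p : H),
    X.Φ (B₀ a) (B₁ p) = B₁ (X.Φ (a * B₀ a) (p * B₁ p) * X.Φ (B₀ a) (B₁ p)⁻¹)

/-- The infinitesimal action of `𝔤` on `𝔥`: the derivative at `a = 1` in the direction `x` of the
map `a ↦ d(Φ a)₁ u` from `G` to the vector space `𝔥`. -/
noncomputable def infinitesimalAction (X : LieGroupCrossedModule E F H G)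
    (x : GroupLieAlgebra 𝓘(ℝ, F) G) (u : GroupLieAlgebra 𝓘(ℝ, E) H) :
    GroupLieAlgebra 𝓘(ℝ, E) H :=
  mfderiv (M' := E) 𝓘(ℝ, F) 𝓘(ℝ, E) (fun a : G => tangentAtOne E E (X.Φ a) u) 1 x

/-- `C` is the crossed module of Lie algebras `(𝔥, 𝔤, dt, φ)` of the crossed module of Lie groups
`X`. There is at most one such `C`. -/
structure IsAssociated [CompleteSpace E] [CompleteSpace F] (X : LieGroupCrossedModule E F H G)
    (C : LieAlgCrossedModule (GroupLieAlgebra 𝓘(ℝ, E) H) (GroupLieAlgebra 𝓘(ℝ, F) G)) : Prop where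
  t_eq : ∀ u, C.t u = tangentAtOne E F X.t u
  φ_eq : ∀ x u, C.φ x u = X.infinitesimalAction x u

end LieGroupCrossedModule

/-! Let `λ(a)` be the tangent map of `Φ a` at the identity and `D` the derivative of `λ` at the
identity (`linearization`, `derivAction`), so that `D` is the infinitesimal action. For `G` acting
on itself by conjugation, `λ` is `Ad` and `D` is `ad`. Each claim comes from a group identity:
differentiate in the variable of `H` to get an identity between values of `λ`, differentiate that in
the variable of `G`, and use uniqueness of derivatives.

The bracket is defined by left-invariant vector fields, so `ad` must be identified with it
(`derivAction_conj_eq_bracket`). In a chart at the identity the bracket is the antisymmetrised mixed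
second derivative of the multiplication; differentiating `R_a ∘ Ad_a = L_a` at `a = 1` gives the
same expression for `ad`.

The Rota-Baxter identity on a single group implies the action compatibility for the conjugation
crossed module (`conj_eq`), so `derivAction_rotaBaxter` yields both infinitesimal identities. -/

open Filter Topology

/-! ### Calculus of tangent maps at the identity. -/

section Tangent

variable {E F K : Type*} [NormedAddCommGroup E] [NormedSpace ℝ E]
  [NormedAddCommGroup F] [NormedSpace ℝ F] [NormedAddCommGroup K] [NormedSpace ℝ K]
  {H : Type*} [TopologicalSpace H] [ChartedSpace E H] [Group H]
  {G : Type*} [TopologicalSpace G] [ChartedSpace F G] [Group G]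
  {L : Type*} [TopologicalSpace L] [ChartedSpace K L] [Group L]

variable (E F) in
/-- The tangent map at the identity, as a map between the model vector spaces. -/
noncomputable def modelTangent (f : H → G) : E →L[ℝ] F :=
  tangentAtOne E F f

theorem hasMFDerivAt_modelTangent {f : H → G} (hf : MDifferentiableAt 𝓘(ℝ, E) 𝓘(ℝ, F) f 1) :
    HasMFDerivAt 𝓘(ℝ, E) 𝓘(ℝ, F) f 1 (modelTangent E F f) :=
  hf.hasMFDerivAt

theorem modelTangent_comp {f : H → G} {g : G → L}
    (hg : MDifferentiableAt 𝓘(ℝ, F) 𝓘(ℝ, K) g 1) (hf : MDifferentiableAt 𝓘(ℝ, E) 𝓘(ℝ, F) f 1)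
    (h1 : f 1 = 1) :
    modelTangent E K (fun p => g (f p)) = (modelTangent F K g).comp (modelTangent E F f) :=
  (HasMFDerivAt.comp (x := (1 : H)) (g := g) (g' := modelTangent F K g)
    (by rw [h1]; exact hg.hasMFDerivAt) hf.hasMFDerivAt).mfderiv

theorem modelTangent_id : modelTangent E E (fun p : H => p) = ContinuousLinearMap.id ℝ E :=
  mfderiv_id

theorem modelTangent_const (g : G) : modelTangent E F (fun _ : H => g) = 0 :=
  mfderiv_const

end Tangent

section Mul

variable {E F : Type*} [NormedAddCommGroup E] [NormedSpace ℝ E]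
  [NormedAddCommGroup F] [NormedSpace ℝ F]
  {H : Type*} [TopologicalSpace H] [ChartedSpace E H] [Group H]
  {G : Type*} [TopologicalSpace G] [ChartedSpace F G] [Group G] [LieGroup 𝓘(ℝ, F) ∞ G]

/-- Both partial derivatives of the multiplication at `(1, 1)` are the identity, since `z * 1 = z =
1 * z`. -/
theorem modelTangent_mul {f g : H → G}
    (hf : MDifferentiableAt 𝓘(ℝ, E) 𝓘(ℝ, F) f 1) (hg : MDifferentiableAt 𝓘(ℝ, E) 𝓘(ℝ, F) g 1)
    (hf1 : f 1 = 1) (hg1 : g 1 = 1) :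
    modelTangent E F (fun p => f p * g p) = modelTangent E F f + modelTangent E F g := by
  have hm : MDifferentiableAt (𝓘(ℝ, F).prod 𝓘(ℝ, F)) 𝓘(ℝ, F)
      (fun z : G × G => z.1 * z.2) ((1 : G), (1 : G)) :=
    (contMDiff_mul 𝓘(ℝ, F) ∞).mdifferentiableAt (by simp)
  have hmul := hm.hasMFDerivAt
  have hpair := HasMFDerivAt.prodMk (hasMFDerivAt_modelTangent hf) (hasMFDerivAt_modelTangent hg)
  have hcomp := HasMFDerivAt.comp (x := (1 : H)) (g := fun z : G × G => z.1 * z.2)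
    (g' := mfderiv (𝓘(ℝ, F).prod 𝓘(ℝ, F)) 𝓘(ℝ, F) (fun z : G × G => z.1 * z.2) ((1 : G), (1 : G)))
    (by rw [hf1, hg1]; exact hmul) hpair
  have key := hcomp.mfderiv
  ext v
  have e1 : modelTangent E F (fun p => f p * g p) v =
      mfderiv (𝓘(ℝ, F).prod 𝓘(ℝ, F)) 𝓘(ℝ, F) (fun z : G × G => z.1 * z.2) ((1 : G), (1 : G))
        (modelTangent E F f v, modelTangent E F g v) :=
    DFunLike.congr_fun key v
  refine e1.trans ((mfderiv_prod_eq_add_apply hm).trans ?_)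
  have e2 : modelTangent F F (fun z : G => z * 1) = ContinuousLinearMap.id ℝ F := by
    simp only [mul_one]
    exact modelTangent_id
  have e3 : modelTangent F F (fun z : G => 1 * z) = ContinuousLinearMap.id ℝ F := by
    simp only [one_mul]
    exact modelTangent_id
  exact congrArg₂ (fun a b : F => a + b) (DFunLike.congr_fun e2 (modelTangent E F f v : F))
    (DFunLike.congr_fun e3 (modelTangent E F g v : F))

theorem modelTangent_inv {f : H → G} (hf : MDifferentiableAt 𝓘(ℝ, E) 𝓘(ℝ, F) f 1)
    (hf1 : f 1 = 1) :
    modelTangent E F (fun p => (f p)⁻¹) = -modelTangent E F f := by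
  have hi : MDifferentiableAt 𝓘(ℝ, E) 𝓘(ℝ, F) (fun p => (f p)⁻¹) 1 :=
    ((contMDiff_inv 𝓘(ℝ, F) ∞).mdifferentiableAt (by simp)).comp 1 hf
  have h := modelTangent_mul hf hi hf1 (by simp [hf1])
  simp only [mul_inv_cancel, modelTangent_const] at h
  exact (neg_eq_of_add_eq_zero_right h.symm).symm

end Mul

/-! ### Derivatives at the identity of vector-valued maps. -/

section VectorValued

variable {F V W : Type*} [NormedAddCommGroup F] [NormedSpace ℝ F]
  [NormedAddCommGroup V] [NormedSpace ℝ V] [NormedAddCommGroup W] [NormedSpace ℝ W]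
  {G : Type*} [TopologicalSpace G] [ChartedSpace F G] [Group G]

/-- A vector-valued map on a Lie group, read in the preferred chart at the identity, has derivative
`f'` at the identity. -/
def HasFDerivAtOne (f : G → V) (f' : F →L[ℝ] V) : Prop :=
  HasFDerivAt (fun z => f ((extChartAt 𝓘(ℝ, F) (1 : G)).symm z)) f' (extChartAt 𝓘(ℝ, F) (1 : G) 1)

theorem HasMFDerivAt.hasFDerivAtOne {f : G → V} {f' : F →L[ℝ] V}
    (h : HasMFDerivAt 𝓘(ℝ, F) 𝓘(ℝ, V) f (1 : G) f') : HasFDerivAtOne f f' := by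
  have h2 : HasFDerivWithinAt (fun z => f ((extChartAt 𝓘(ℝ, F) (1 : G)).symm z)) f'
      (Set.range 𝓘(ℝ, F)) (extChartAt 𝓘(ℝ, F) (1 : G) 1) := h.2
  rwa [ModelWithCorners.range_eq_univ, hasFDerivWithinAt_univ] at h2

theorem MDifferentiableAt.hasFDerivAtOne {f : G → V}
    (h : MDifferentiableAt 𝓘(ℝ, F) 𝓘(ℝ, V) f (1 : G)) :
    HasFDerivAtOne (F := F) (V := V) f (mfderiv 𝓘(ℝ, F) 𝓘(ℝ, V) f (1 : G) : F →L[ℝ] V) :=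
  HasMFDerivAt.hasFDerivAtOne (F := F) (V := V) (f' := (mfderiv 𝓘(ℝ, F) 𝓘(ℝ, V) f (1 : G) : F →L[ℝ] V))
    h.hasMFDerivAt

namespace HasFDerivAtOne

theorem unique {f : G → V} {f₁ f₂ : F →L[ℝ] V} (h₁ : HasFDerivAtOne f f₁)
    (h₂ : HasFDerivAtOne f f₂) : f₁ = f₂ :=
  HasFDerivAt.unique h₁ h₂

theorem congr_of_eventuallyEq {f g : G → V} {f' : F →L[ℝ] V} (h : HasFDerivAtOne f f')
    (hfg : g =ᶠ[𝓝 1] f) : HasFDerivAtOne g f' := by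
  refine HasFDerivAt.congr_of_eventuallyEq h ?_
  have hc := (continuousAt_extChartAt_symm (I := 𝓘(ℝ, F)) (1 : G)).tendsto
  rw [extChartAt_to_inv] at hc
  exact hc.eventually hfg

theorem hasMFDerivAt {f : G → V} {f' : F →L[ℝ] V} (h : HasFDerivAtOne f f') :
    HasMFDerivAt 𝓘(ℝ, F) 𝓘(ℝ, V) f (1 : G) f' := by
  constructor
  · have h1 := ContinuousAt.comp (f := extChartAt 𝓘(ℝ, F) (1 : G)) (x := (1 : G))
      (HasFDerivAt.continuousAt h) (continuousAt_extChartAt (1 : G))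
    refine h1.congr ?_
    filter_upwards [extChartAt_source_mem_nhds (I := 𝓘(ℝ, F)) (1 : G)] with a ha
    simp only [Function.comp_apply]
    rw [(extChartAt 𝓘(ℝ, F) (1 : G)).left_inv ha]
  · rw [ModelWithCorners.range_eq_univ]
    exact HasFDerivAt.hasFDerivWithinAt h

theorem mfderiv {f : G → V} {f' : F →L[ℝ] V} (h : HasFDerivAtOne f f') :
    (mfderiv 𝓘(ℝ, F) 𝓘(ℝ, V) f (1 : G) : F →L[ℝ] V) = f' := by
  have h2 := h.hasMFDerivAt
  exact HasMFDerivAt.mfderiv h2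

theorem clm_apply {c : G → V →L[ℝ] W} {u : G → V} {c' : F →L[ℝ] V →L[ℝ] W} {u' : F →L[ℝ] V}
    (hc : HasFDerivAtOne c c') (hu : HasFDerivAtOne u u') :
    HasFDerivAtOne (fun a => c a (u a)) ((c 1).comp u' + c'.flip (u 1)) := by
  have h := HasFDerivAt.clm_apply hc hu
  simp only [extChartAt_to_inv] at h
  exact h

theorem const_clm_apply {u : G → V} {u' : F →L[ℝ] V} (c : V →L[ℝ] W) (hu : HasFDerivAtOne u u') :
    HasFDerivAtOne (fun a => c (u a)) (c.comp u') :=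
  c.hasFDerivAt.comp _ hu

theorem clm_apply_const {c : G → V →L[ℝ] W} {c' : F →L[ℝ] V →L[ℝ] W}
    (hc : HasFDerivAtOne c c') (v : V) : HasFDerivAtOne (fun a => c a v) (c'.flip v) :=
  const_clm_apply (ContinuousLinearMap.apply ℝ W v) hc

theorem sub {f g : G → V} {f' g' : F →L[ℝ] V} (hf : HasFDerivAtOne f f')
    (hg : HasFDerivAtOne g g') : HasFDerivAtOne (fun a => f a - g a) (f' - g') :=
  HasFDerivAt.sub hf hg

theorem comp_modelTangent {E : Type*} [NormedAddCommGroup E] [NormedSpace ℝ E]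
    {H : Type*} [TopologicalSpace H] [ChartedSpace E H] [Group H] {f : G → V} {f' : F →L[ℝ] V}
    (hf : HasFDerivAtOne f f') {g : H → G} (hg : MDifferentiableAt 𝓘(ℝ, E) 𝓘(ℝ, F) g 1)
    (h1 : g 1 = 1) :
    HasFDerivAtOne (F := E) (fun p => f (g p)) (f'.comp (modelTangent E F g)) :=
  HasMFDerivAt.hasFDerivAtOne (F := E) (f' := f'.comp (modelTangent E F g))
    (HasMFDerivAt.comp (x := (1 : H)) (g := f) (g' := f')
      (by rw [h1]; exact hf.hasMFDerivAt) hg.hasMFDerivAt)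

end HasFDerivAtOne

end VectorValued

/-! ### Dependence of the tangent map on a parameter. -/

section Family

variable {E E' F : Type*} [NormedAddCommGroup E] [NormedSpace ℝ E]
  [NormedAddCommGroup E'] [NormedSpace ℝ E']
  [NormedAddCommGroup F] [NormedSpace ℝ F]
  {H : Type*} [TopologicalSpace H] [ChartedSpace E H] [Group H] [IsManifold 𝓘(ℝ, E) 1 H]
  {H' : Type*} [TopologicalSpace H'] [ChartedSpace E' H'] [Group H'] [IsManifold 𝓘(ℝ, E') 1 H']
  {N : Type*} [TopologicalSpace N] [ChartedSpace F N] [IsManifold 𝓘(ℝ, F) 1 N]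

/-- Smoothness of `mfderiv` in a parameter is available in tangent coordinates. All base points and
their images are `1`, so these coordinate changes are the identity. -/
theorem mdifferentiableAt_modelTangent_family {f : N → H → H'} {x₀ : N}
    (hf : ContMDiffAt (𝓘(ℝ, F).prod 𝓘(ℝ, E)) 𝓘(ℝ, E') ∞ (Function.uncurry f) (x₀, 1))
    (h1 : ∀ n, f n 1 = 1) :
    MDifferentiableAt 𝓘(ℝ, F) 𝓘(ℝ, E →L[ℝ] E')
      (fun n => modelTangent E E' (f n)) x₀ := by
  have h := ContMDiffAt.mfderiv (m := 1) f (fun _ => (1 : H)) hf contMDiffAt_const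
    (by norm_cast)
  have h2 := h.mdifferentiableAt (by simp)
  refine (congrArg (fun A : N → E →L[ℝ] E' => MDifferentiableAt 𝓘(ℝ, F) 𝓘(ℝ, E →L[ℝ] E') A x₀)
    (funext fun n => ?_)).mp h2
  rw [inTangentCoordinates_eq_mfderiv_comp (by simp) (by simp [h1])]
  ext v
  have hs : ∀ w : E, (mfderivWithin 𝓘(ℝ, E) 𝓘(ℝ, E) (extChartAt 𝓘(ℝ, E) (1 : H)).symm
      (Set.range 𝓘(ℝ, E)) (extChartAt 𝓘(ℝ, E) (1 : H) 1) w : E) = w := fun w =>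
    DFunLike.congr_fun (mfderivWithin_range_extChartAt_symm (I := 𝓘(ℝ, E)) (x := (1 : H))) w
  have ht : ∀ q q' : H', q = 1 → q' = 1 → ∀ w : E',
      (mfderiv 𝓘(ℝ, E') 𝓘(ℝ, E') (extChartAt 𝓘(ℝ, E') q) q' w : E') = w := by
    rintro _ _ rfl rfl w
    exact DFunLike.congr_fun (mfderiv_extChartAt_self (I := 𝓘(ℝ, E')) (x := (1 : H'))) w
  exact (ht _ _ (h1 x₀) (h1 n) _).trans (congrArg (mfderiv 𝓘(ℝ, E) 𝓘(ℝ, E') (f n) 1) (hs v))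

end Family

/-! ### Mixed second derivatives. -/

section PartialDerivatives

variable {E K : Type*} [NormedAddCommGroup E] [NormedSpace ℝ E]
  [NormedAddCommGroup K] [NormedSpace ℝ K]

/-- `L x y = D²m((x,0),(0,y))` and `R x y = D²m((0,x),(y,0))`; symmetry of `D²m` relates them. -/
theorem exists_hasFDerivAt_partial_fderiv {m : E × E → K} {c : E}
    (hm : ContDiffAt ℝ 2 m (c, c)) :
    ∃ L R : E →L[ℝ] E →L[ℝ] K,
      HasFDerivAt (fun z => fderiv ℝ (fun w => m (z, w)) c) L c ∧
      HasFDerivAt (fun z => fderiv ℝ (fun w => m (w, z)) c) R c ∧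
      ∀ x y, R x y = L y x := by
  have hd : HasFDerivAt (fderiv ℝ m) (fderiv ℝ (fderiv ℝ m) (c, c)) (c, c) :=
    ((hm.fderiv_right (m := 1) (by norm_num)).differentiableAt (by simp)).hasFDerivAt
  have hev : ∀ᶠ z in 𝓝 (c, c), DifferentiableAt ℝ m z := by
    filter_upwards [hm.eventually (by simp)] with z hz using hz.differentiableAt (by simp)
  have hl : HasFDerivAt (fun z : E => (z, c)) (ContinuousLinearMap.inl ℝ E E) c :=
    hasFDerivAt_prodMk_left c c
  have hr : HasFDerivAt (fun z : E => (c, z)) (ContinuousLinearMap.inr ℝ E E) c :=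
    hasFDerivAt_prodMk_right c c
  refine ⟨((ContinuousLinearMap.compL ℝ E (E × E) K).flip (.inr ℝ E E)).comp
      ((fderiv ℝ (fderiv ℝ m) (c, c)).comp (.inl ℝ E E)),
    ((ContinuousLinearMap.compL ℝ E (E × E) K).flip (.inl ℝ E E)).comp
      ((fderiv ℝ (fderiv ℝ m) (c, c)).comp (.inr ℝ E E)), ?_, ?_, ?_⟩
  · refine HasFDerivAt.congr_of_eventuallyEq
      ((ContinuousLinearMap.hasFDerivAt _).comp c
        (hd.comp (f := fun z : E => (z, c)) c hl)) ?_
    filter_upwards [hl.continuousAt.eventually hev] with z hz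
    exact (hz.hasFDerivAt.comp c (hasFDerivAt_prodMk_right z c)).fderiv
  · refine HasFDerivAt.congr_of_eventuallyEq
      ((ContinuousLinearMap.hasFDerivAt _).comp c
        (hd.comp (f := fun z : E => (c, z)) c hr)) ?_
    filter_upwards [hr.continuousAt.eventually hev] with z hz
    exact (hz.hasFDerivAt.comp c (hasFDerivAt_prodMk_left c z)).fderiv
  · intro x y
    exact (hm.isSymmSndFDerivAt (by simp)).eq _ _

end PartialDerivatives

/-! ### Translations and the Lie bracket in the chart at the identity. -/

section Translations

variable {F : Type*} [NormedAddCommGroup F] [NormedSpace ℝ F]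
  {G : Type*} [TopologicalSpace G] [ChartedSpace F G] [Group G]

variable (F) in
/-- The derivative at the identity of left translation by `a`, read in the preferred chart at the
identity of the Lie group. -/
noncomputable def leftTranslationDeriv (a : G) : F →L[ℝ] F :=
  fderiv ℝ (fun w => extChartAt 𝓘(ℝ, F) (1 : G) (a * (extChartAt 𝓘(ℝ, F) (1 : G)).symm w))
    (extChartAt 𝓘(ℝ, F) (1 : G) 1)

variable (F) in
/-- The derivative at the identity of right translation by `a`, read in the preferred chart at the
identity of the Lie group. -/
noncomputable def rightTranslationDeriv (a : G) : F →L[ℝ] F :=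
  fderiv ℝ (fun w => extChartAt 𝓘(ℝ, F) (1 : G) ((extChartAt 𝓘(ℝ, F) (1 : G)).symm w * a))
    (extChartAt 𝓘(ℝ, F) (1 : G) 1)

theorem fderiv_extChartAt_comp_symm_one :
    fderiv ℝ (fun w => extChartAt 𝓘(ℝ, F) (1 : G) ((extChartAt 𝓘(ℝ, F) (1 : G)).symm w))
      (extChartAt 𝓘(ℝ, F) (1 : G) 1) = ContinuousLinearMap.id ℝ F := by
  have h : (fun w => extChartAt 𝓘(ℝ, F) (1 : G) ((extChartAt 𝓘(ℝ, F) (1 : G)).symm w))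
      =ᶠ[𝓝 (extChartAt 𝓘(ℝ, F) (1 : G) 1)] id := by
    filter_upwards [extChartAt_target_mem_nhds (I := 𝓘(ℝ, F)) (1 : G)] with w hw
    exact (extChartAt 𝓘(ℝ, F) (1 : G)).right_inv hw
  rw [h.fderiv_eq, fderiv_id]

theorem leftTranslationDeriv_one : leftTranslationDeriv F (1 : G) = ContinuousLinearMap.id ℝ F := by
  simpa only [leftTranslationDeriv, one_mul] using fderiv_extChartAt_comp_symm_one

theorem rightTranslationDeriv_one :
    rightTranslationDeriv F (1 : G) = ContinuousLinearMap.id ℝ F := by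
  simpa only [rightTranslationDeriv, mul_one] using fderiv_extChartAt_comp_symm_one

variable [LieGroup 𝓘(ℝ, F) ∞ G]

theorem hasMFDerivAt_extChartAt_mul_left {a : G} (ha : a ∈ (chartAt F (1 : G)).source) :
    HasMFDerivAt 𝓘(ℝ, F) 𝓘(ℝ, F) (fun b => extChartAt 𝓘(ℝ, F) (1 : G) (a * b)) (1 : G)
      ((mfderiv 𝓘(ℝ, F) 𝓘(ℝ, F) (extChartAt 𝓘(ℝ, F) (1 : G)) a : F →L[ℝ] F).comp
        (mfderiv 𝓘(ℝ, F) 𝓘(ℝ, F) (a * ·) 1 : F →L[ℝ] F)) :=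
  HasMFDerivAt.comp (x := (1 : G)) (g := extChartAt 𝓘(ℝ, F) (1 : G))
    (g' := mfderiv 𝓘(ℝ, F) 𝓘(ℝ, F) (extChartAt 𝓘(ℝ, F) (1 : G)) a)
    (by rw [mul_one]; exact (mdifferentiableAt_extChartAt ha).hasMFDerivAt)
    (contMDiff_mul_left.mdifferentiableAt (n := ∞) (by simp)).hasMFDerivAt

theorem hasFDerivAtOne_extChartAt_mul_left {a : G} (ha : a ∈ (chartAt F (1 : G)).source) :
    HasFDerivAtOne (fun b => extChartAt 𝓘(ℝ, F) (1 : G) (a * b)) (leftTranslationDeriv F a) :=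
  (HasFDerivAt.differentiableAt (HasMFDerivAt.hasFDerivAtOne (F := F)
    (hasMFDerivAt_extChartAt_mul_left ha))).hasFDerivAt

theorem hasFDerivAtOne_extChartAt_mul_right {a : G} (ha : a ∈ (chartAt F (1 : G)).source) :
    HasFDerivAtOne (fun b => extChartAt 𝓘(ℝ, F) (1 : G) (b * a)) (rightTranslationDeriv F a) :=
  (HasFDerivAt.differentiableAt (HasMFDerivAt.hasFDerivAtOne (F := F)
    (HasMFDerivAt.comp (x := (1 : G)) (g := extChartAt 𝓘(ℝ, F) (1 : G))
      (g' := mfderiv 𝓘(ℝ, F) 𝓘(ℝ, F) (extChartAt 𝓘(ℝ, F) (1 : G)) a)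
      (by rw [one_mul]; exact (mdifferentiableAt_extChartAt ha).hasMFDerivAt)
      (contMDiff_mul_right.mdifferentiableAt (n := ∞) (by simp)).hasMFDerivAt))).hasFDerivAt

theorem exists_hasFDerivAtOne_translationDeriv :
    ∃ L R : F →L[ℝ] F →L[ℝ] F,
      HasFDerivAtOne (leftTranslationDeriv F : G → F →L[ℝ] F) L ∧
      HasFDerivAtOne (rightTranslationDeriv F : G → F →L[ℝ] F) R ∧ ∀ x y, R x y = L y x := by
  have hm : ContMDiffAt (𝓘(ℝ, F).prod 𝓘(ℝ, F)) 𝓘(ℝ, F) ∞ (fun z : G × G => z.1 * z.2) (1, 1) :=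
    (contMDiff_mul 𝓘(ℝ, F) ∞).contMDiffAt
  have hc := (contMDiffAt_iff.1 hm).2
  rw [ModelWithCorners.range_eq_univ, contDiffWithinAt_univ] at hc
  simp only [mul_one] at hc
  have hc' : ContDiffAt ℝ ∞ (fun z : F × F => extChartAt 𝓘(ℝ, F) (1 : G)
      ((extChartAt 𝓘(ℝ, F) (1 : G)).symm z.1 * (extChartAt 𝓘(ℝ, F) (1 : G)).symm z.2))
      (extChartAt 𝓘(ℝ, F) (1 : G) 1, extChartAt 𝓘(ℝ, F) (1 : G) 1) := hc
  exact exists_hasFDerivAt_partial_fderiv (hc'.of_le (by norm_cast))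

/-- The inverse of the derivative of the inverse chart is the derivative of the chart; the chain
rule does the rest. -/
theorem mpullbackWithin_mulInvariantVectorField (y : GroupLieAlgebra 𝓘(ℝ, F) G) {z : F}
    (hz : z ∈ (extChartAt 𝓘(ℝ, F) (1 : G)).target) :
    (VectorField.mpullbackWithin 𝓘(ℝ, F) 𝓘(ℝ, F) (extChartAt 𝓘(ℝ, F) (1 : G)).symm
      (mulInvariantVectorField y) (Set.range 𝓘(ℝ, F)) z : F) =
      leftTranslationDeriv F ((extChartAt 𝓘(ℝ, F) (1 : G)).symm z) y := by
  have hs : (extChartAt 𝓘(ℝ, F) (1 : G)).symm z ∈ (chartAt F (1 : G)).source := by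
    rw [← extChartAt_source 𝓘(ℝ, F)]
    exact (extChartAt 𝓘(ℝ, F) (1 : G)).map_target hz
  rw [VectorField.mpullbackWithin_apply, ContinuousLinearMap.inverse_eq
    (mfderivWithin_extChartAt_symm_comp_mfderiv_extChartAt hz)
    (mfderiv_extChartAt_comp_mfderivWithin_extChartAt_symm hz)]
  exact DFunLike.congr_fun ((HasMFDerivAt.hasFDerivAtOne (F := F)
    (hasMFDerivAt_extChartAt_mul_left hs)).unique (hasFDerivAtOne_extChartAt_mul_left hs)) y

theorem GroupLieAlgebra.bracket_eq_sub {L : F →L[ℝ] F →L[ℝ] F}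
    (hL : HasFDerivAtOne (leftTranslationDeriv F : G → F →L[ℝ] F) L)
    (x y : F) :
    Bracket.bracket (L := GroupLieAlgebra 𝓘(ℝ, F) G) (M := GroupLieAlgebra 𝓘(ℝ, F) G) x y =
      L x y - L y x := by
  let U : F → F → F := fun v =>
    VectorField.mpullbackWithin 𝓘(ℝ, F) 𝓘(ℝ, F) (extChartAt 𝓘(ℝ, F) (1 : G)).symm
      (mulInvariantVectorField v) (Set.range 𝓘(ℝ, F))
  have hU : ∀ v, U v =ᶠ[𝓝 (extChartAt 𝓘(ℝ, F) (1 : G) 1)]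
      fun z => leftTranslationDeriv F ((extChartAt 𝓘(ℝ, F) (1 : G)).symm z) v := fun v => by
    filter_upwards [extChartAt_target_mem_nhds (I := 𝓘(ℝ, F)) (1 : G)] with z hz
    exact mpullbackWithin_mulInvariantVectorField v hz
  have hd : ∀ v : F, fderiv ℝ (fun z => leftTranslationDeriv F
      ((extChartAt 𝓘(ℝ, F) (1 : G)).symm z) v) (extChartAt 𝓘(ℝ, F) (1 : G) 1) = L.flip v :=
    fun v => HasFDerivAt.fderiv (hL.clm_apply_const v)
  have h1 : ∀ v : F, leftTranslationDeriv F
      ((extChartAt 𝓘(ℝ, F) (1 : G)).symm (extChartAt 𝓘(ℝ, F) (1 : G) 1)) v = v := fun v => by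
    rw [extChartAt_to_inv, leftTranslationDeriv_one, ContinuousLinearMap.id_apply]
  -- The bracket computed in the chart is carried back to the group by this map, which is trivial at
  -- the identity.
  have hb : ∀ w : F, ((mfderiv 𝓘(ℝ, F) 𝓘(ℝ, F) (extChartAt 𝓘(ℝ, F) (1 : G)) 1).inverse w : F) = w := by
    have h : (mfderiv 𝓘(ℝ, F) 𝓘(ℝ, F) (extChartAt 𝓘(ℝ, F) (1 : G)) 1 : F →L[ℝ] F) = .id ℝ F :=
      mfderiv_extChartAt_self
    have h' : ∀ A : F →L[ℝ] F, A = .id ℝ F → ∀ w, A.inverse w = w := by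
      rintro _ rfl w
      rw [ContinuousLinearMap.inverse_id, ContinuousLinearMap.id_apply]
    exact h' _ h
  have hset : (extChartAt 𝓘(ℝ, F) (1 : G)).symm ⁻¹' Set.univ ∩ Set.range 𝓘(ℝ, F) = Set.univ := by
    rw [ModelWithCorners.range_eq_univ, Set.preimage_univ, Set.univ_inter]
  have key : VectorField.lieBracketWithin ℝ (U x) (U y)
      ((extChartAt 𝓘(ℝ, F) (1 : G)).symm ⁻¹' Set.univ ∩ Set.range 𝓘(ℝ, F))
      (extChartAt 𝓘(ℝ, F) (1 : G) 1) = L x y - L y x := by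
    rw [hset, VectorField.lieBracketWithin_univ, (hU x).lieBracket_vectorField_eq (hU y),
      VectorField.lieBracket, hd, hd, h1, h1]
    rfl
  exact (hb _).trans key

end Translations

/-! ### The linearised action and its derivative. -/

namespace LieGroupCrossedModule

variable {E F : Type*} [NormedAddCommGroup E] [NormedSpace ℝ E]
  [NormedAddCommGroup F] [NormedSpace ℝ F]
  {H : Type*} [TopologicalSpace H] [ChartedSpace E H] [Group H] [LieGroup 𝓘(ℝ, E) ∞ H]
  {G : Type*} [TopologicalSpace G] [ChartedSpace F G] [Group G] [LieGroup 𝓘(ℝ, F) ∞ G]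

variable (F G) in
/-- The crossed module `(G, G, id, conj)` of a Lie group `G` acting on itself by conjugation. -/
def conj : LieGroupCrossedModule F F G G where
  t := MonoidHom.id G
  contMDiff_t := contMDiff_id
  Φ := MulAut.conj
  contMDiff_Φ := (contMDiff_fst.mul contMDiff_snd).mul contMDiff_fst.inv
  act_map _ _ := rfl
  map_act _ _ := rfl

/-- The linear action `a ↦ d(Φ a)₁` of `G` on the Lie algebra of `H`. -/
noncomputable def linearization (X : LieGroupCrossedModule E F H G) (a : G) : E →L[ℝ] E :=
  modelTangent E E (X.Φ a)

/-- The derivative at the identity of the linear action of `G` on the Lie algebra of `H`. -/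
noncomputable def derivAction (X : LieGroupCrossedModule E F H G) : F →L[ℝ] E →L[ℝ] E :=
  mfderiv 𝓘(ℝ, F) 𝓘(ℝ, E →L[ℝ] E) X.linearization 1

variable (X : LieGroupCrossedModule E F H G)

theorem hasFDerivAtOne_linearization : HasFDerivAtOne X.linearization X.derivAction :=
  MDifferentiableAt.hasFDerivAtOne (F := F) (V := E →L[ℝ] E)
    (mdifferentiableAt_modelTangent_family (f := fun a p => X.Φ a p) X.contMDiff_Φ.contMDiffAt
      (fun a => map_one (X.Φ a)))

theorem infinitesimalAction_eq (x : GroupLieAlgebra 𝓘(ℝ, F) G) (u : GroupLieAlgebra 𝓘(ℝ, E) H) :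
    X.infinitesimalAction x u = X.derivAction x u :=
  DFunLike.congr_fun (X.hasFDerivAtOne_linearization.clm_apply_const u).mfderiv x

theorem mdifferentiableAt_t {p : H} : MDifferentiableAt 𝓘(ℝ, E) 𝓘(ℝ, F) X.t p :=
  X.contMDiff_t.mdifferentiable (by simp) p

theorem contMDiff_act (a : G) : ContMDiff 𝓘(ℝ, E) 𝓘(ℝ, E) ∞ (X.Φ a) :=
  X.contMDiff_Φ.comp (contMDiff_const.prodMk contMDiff_id)

theorem mdifferentiableAt_act (a : G) {p : H} : MDifferentiableAt 𝓘(ℝ, E) 𝓘(ℝ, E) (X.Φ a) p :=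
  (X.contMDiff_act a).mdifferentiable (by simp) p

theorem linearization_mul (a b : G) :
    X.linearization (a * b) = (X.linearization a).comp (X.linearization b) := by
  rw [linearization, map_mul]
  exact modelTangent_comp (X.mdifferentiableAt_act a) (X.mdifferentiableAt_act b)
    (map_one (X.Φ b))

theorem linearization_one : X.linearization 1 = ContinuousLinearMap.id ℝ E := by
  rw [linearization, map_one]
  exact modelTangent_id

theorem modelTangent_comp_linearization_conj {f : H →* G}
    (hf : ContMDiff 𝓘(ℝ, E) 𝓘(ℝ, F) ∞ f) (p : H) :
    (modelTangent E F f).comp ((conj E H).linearization p) =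
      ((conj F G).linearization (f p)).comp (modelTangent E F f) := by
  have hf1 := hf.mdifferentiable (by simp) 1
  rw [linearization, linearization,
    ← modelTangent_comp hf1 ((conj E H).mdifferentiableAt_act p) (map_one _),
    ← modelTangent_comp ((conj F G).mdifferentiableAt_act (f p)) hf1 (map_one _)]
  congr 1
  funext q
  simp [conj]

/-- Derivative in `p` of `df ∘ Ad_p = Ad_{f(p)} ∘ df`. It serves both for `t` and for each
automorphism `Φ a`. -/
theorem derivAction_conj_map {f : H →* G} (hf : ContMDiff 𝓘(ℝ, E) 𝓘(ℝ, F) ∞ f) (u v : E) :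
    modelTangent E F f ((conj E H).derivAction u v) =
      (conj F G).derivAction (modelTangent E F f u) (modelTangent E F f v) := by
  have hf1 := hf.mdifferentiable (by simp) 1
  have h1 := ((conj E H).hasFDerivAtOne_linearization.clm_apply_const v).const_clm_apply
    (modelTangent E F f)
  have h2 := ((conj F G).hasFDerivAtOne_linearization.comp_modelTangent hf1
    (map_one f)).clm_apply_const (modelTangent E F f v)
  have h3 : (fun p => modelTangent E F f ((conj E H).linearization p v)) =
      fun p => (conj F G).linearization (f p) (modelTangent E F f v) :=
    funext fun p => DFunLike.congr_fun (modelTangent_comp_linearization_conj hf p) v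
  rw [h3] at h1
  exact DFunLike.congr_fun (h1.unique h2) u

/-- Derivative in `b` of `(a b a⁻¹) a = a b`. -/
theorem rightTranslationDeriv_comp_linearization_conj {a : G}
    (ha : a ∈ (chartAt F (1 : G)).source) :
    (rightTranslationDeriv F a).comp ((conj F G).linearization a) = leftTranslationDeriv F a := by
  have h1 := (hasFDerivAtOne_extChartAt_mul_right ha).comp_modelTangent
    ((conj F G).mdifferentiableAt_act a) (map_one _)
  have h2 := hasFDerivAtOne_extChartAt_mul_left ha
  refine h1.unique ?_
  simpa [conj] using h2

theorem derivAction_conj_eq_bracket (x y : F) :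
    (conj F G).derivAction x y =
      Bracket.bracket (L := GroupLieAlgebra 𝓘(ℝ, F) G) (M := GroupLieAlgebra 𝓘(ℝ, F) G) x y := by
  obtain ⟨L, R, hL, hR, hLR⟩ := exists_hasFDerivAtOne_translationDeriv (F := F) (G := G)
  rw [GroupLieAlgebra.bracket_eq_sub hL, ← hLR x y, eq_sub_iff_add_eq]
  -- The product rule for `R_a (Ad_a y) = L_a y` at `a = 1` reads `ad x y + R x y = L x y`. The
  -- identity is known only for `a` in the chart domain, which suffices.
  have h1 := hR.clm_apply ((conj F G).hasFDerivAtOne_linearization.clm_apply_const y)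
  have h2 := h1.unique ((hL.clm_apply_const y).congr_of_eventuallyEq ?_)
  · simpa [rightTranslationDeriv_one, linearization_one] using DFunLike.congr_fun h2 x
  · filter_upwards [chart_source_mem_nhds F (1 : G)] with a ha
    exact DFunLike.congr_fun (rightTranslationDeriv_comp_linearization_conj ha) y

theorem bracket_eq (x y : GroupLieAlgebra 𝓘(ℝ, F) G) : ⁅x, y⁆ = (conj F G).derivAction x y :=
  (derivAction_conj_eq_bracket (F := F) (G := G) x y).symm

theorem linearization_conj (a b : G) : X.linearization (a * b * a⁻¹) * X.linearization a =
    X.linearization a * X.linearization b := by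
  rw [ContinuousLinearMap.mul_def, ContinuousLinearMap.mul_def, ← linearization_mul,
    ← linearization_mul, inv_mul_cancel_right]

/-- Derivative in `b` of `λ(a b a⁻¹) λ(a) = λ(a) λ(b)`. Differentiating the result in `a` gives the
homomorphism property of `D`. -/
theorem derivAction_linearization_conj (a : G) (y : F) (u : E) :
    X.derivAction ((conj F G).linearization a y) (X.linearization a u) =
      X.linearization a (X.derivAction y u) := by
  have h1 := (X.hasFDerivAtOne_linearization.comp_modelTangent
    ((conj F G).mdifferentiableAt_act a) (map_one _)).clm_apply_const (X.linearization a u)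
  have h2 := (X.hasFDerivAtOne_linearization.clm_apply_const u).const_clm_apply (X.linearization a)
  have h3 : (fun b => X.linearization ((conj F G).Φ a b) (X.linearization a u)) =
      fun b => X.linearization a (X.linearization b u) :=
    funext fun b => DFunLike.congr_fun (X.linearization_conj a b) u
  rw [h3] at h1
  exact DFunLike.congr_fun (h1.unique h2) y

theorem derivAction_derivAction_conj (x y : F) (u : E) :
    X.derivAction ((conj F G).derivAction x y) u =
      X.derivAction x (X.derivAction y u) - X.derivAction y (X.derivAction x u) := by
  have h1 := (((conj F G).hasFDerivAtOne_linearization.clm_apply_const y).const_clm_apply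
    X.derivAction).clm_apply (X.hasFDerivAtOne_linearization.clm_apply_const u)
  have h2 := X.hasFDerivAtOne_linearization.clm_apply_const (X.derivAction y u)
  simp only [derivAction_linearization_conj] at h1
  have h3 := DFunLike.congr_fun (h1.unique h2) x
  simp [linearization_one] at h3
  rw [eq_sub_iff_add_eq', h3]

/-- Each `λ(a)` preserves the bracket; the product rule in `a` turns this into the Leibniz rule. -/
theorem derivAction_derivation (x : F) (u v : E) :
    X.derivAction x ((conj E H).derivAction u v) =
      (conj E H).derivAction (X.derivAction x u) v +
        (conj E H).derivAction u (X.derivAction x v) := by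
  have h1 := X.hasFDerivAtOne_linearization.clm_apply_const ((conj E H).derivAction u v)
  have h2 := ((X.hasFDerivAtOne_linearization.clm_apply_const u).const_clm_apply
    (conj E H).derivAction).clm_apply (X.hasFDerivAtOne_linearization.clm_apply_const v)
  have h3 : (fun a => X.linearization a ((conj E H).derivAction u v)) =
      fun a => (conj E H).derivAction (X.linearization a u) (X.linearization a v) :=
    funext fun a => derivAction_conj_map (f := (X.Φ a).toMonoidHom) (X.contMDiff_act a) u v
  rw [h3] at h1
  have h4 := DFunLike.congr_fun (h1.unique h2) x
  simp [linearization_one] at h4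
  rw [h4, add_comm]

theorem modelTangent_t_derivAction (x : F) (u : E) :
    modelTangent E F X.t (X.derivAction x u) =
      (conj F G).derivAction x (modelTangent E F X.t u) := by
  have h1 := (X.hasFDerivAtOne_linearization.clm_apply_const u).const_clm_apply
    (modelTangent E F X.t)
  have h2 := (conj F G).hasFDerivAtOne_linearization.clm_apply_const (modelTangent E F X.t u)
  have h3 : (fun a => modelTangent E F X.t (X.linearization a u)) =
      fun a => (conj F G).linearization a (modelTangent E F X.t u) := by
    funext a
    refine DFunLike.congr_fun (f := (modelTangent E F X.t).comp (X.linearization a))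
      (g := ((conj F G).linearization a).comp (modelTangent E F X.t)) ?_ u
    rw [linearization, linearization,
      ← modelTangent_comp X.mdifferentiableAt_t (X.mdifferentiableAt_act a) (map_one _),
      ← modelTangent_comp ((conj F G).mdifferentiableAt_act a) X.mdifferentiableAt_t (map_one _)]
    congr 1
    funext p
    exact X.map_act a p
  rw [h3] at h1
  exact DFunLike.congr_fun (h1.unique h2) x

theorem derivAction_modelTangent_t (u v : E) :
    X.derivAction (modelTangent E F X.t u) v = (conj E H).derivAction u v := by
  have h1 := (X.hasFDerivAtOne_linearization.comp_modelTangent X.mdifferentiableAt_t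
    (map_one X.t)).clm_apply_const v
  have h2 := (conj E H).hasFDerivAtOne_linearization.clm_apply_const v
  have h3 : (fun p => X.linearization (X.t p) v) = fun p => (conj E H).linearization p v := by
    funext p
    simp only [linearization]
    congr 2
    funext q
    exact X.act_map p q
  rw [h3] at h1
  exact DFunLike.congr_fun (h1.unique h2) u

/-- The derivative at the identity of the compatibility of a Rota-Baxter operator with the
action. -/
theorem derivAction_rotaBaxter {B₁ : H → H} {B₀ : G → G}
    (hB₁ : ContMDiff 𝓘(ℝ, E) 𝓘(ℝ, E) ∞ B₁) (hB₀ : ContMDiff 𝓘(ℝ, F) 𝓘(ℝ, F) ∞ B₀)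
    (h₁ : B₁ 1 = 1) (h₀ : B₀ 1 = 1)
    (hact : ∀ (a : G) (p : H),
      X.Φ (B₀ a) (B₁ p) = B₁ (X.Φ (a * B₀ a) (p * B₁ p) * X.Φ (B₀ a) (B₁ p)⁻¹)) (x : F) (u : E) :
    X.derivAction (modelTangent F F B₀ x) (modelTangent E E B₁ u) =
      modelTangent E E B₁ (X.derivAction x (modelTangent E E B₁ u) +
        X.derivAction (modelTangent F F B₀ x) u + X.derivAction x u) := by
  have d₁ : MDifferentiableAt 𝓘(ℝ, E) 𝓘(ℝ, E) B₁ 1 := hB₁.mdifferentiable (by simp) 1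
  have d₀ : MDifferentiableAt 𝓘(ℝ, F) 𝓘(ℝ, F) B₀ 1 := hB₀.mdifferentiable (by simp) 1
  -- Derivative of `hact` in `p`, with `a` fixed.
  have hlin : ∀ a, X.linearization (B₀ a) (modelTangent E E B₁ u) =
      modelTangent E E B₁ (X.linearization (a * B₀ a) (u + modelTangent E E B₁ u) -
        X.linearization (B₀ a) (modelTangent E E B₁ u)) := by
    intro a
    have e1 : modelTangent E E (fun p => X.Φ (B₀ a) (B₁ p)) =
        (X.linearization (B₀ a)).comp (modelTangent E E B₁) :=
      modelTangent_comp (X.mdifferentiableAt_act _) d₁ h₁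
    have dm : MDifferentiableAt 𝓘(ℝ, E) 𝓘(ℝ, E) (fun p : H => p * B₁ p) 1 :=
      (contMDiff_id.mul hB₁).mdifferentiable (by simp) 1
    have di : MDifferentiableAt 𝓘(ℝ, E) 𝓘(ℝ, E) (fun p : H => (B₁ p)⁻¹) 1 :=
      hB₁.inv.mdifferentiable (by simp) 1
    have e2 : modelTangent E E (fun p => X.Φ (a * B₀ a) (p * B₁ p)) =
        (X.linearization (a * B₀ a)).comp (.id ℝ E + modelTangent E E B₁) := by
      rw [modelTangent_comp (X.mdifferentiableAt_act _) dm (by simp [h₁]),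
        modelTangent_mul (f := fun p => p) mdifferentiableAt_id d₁ rfl h₁, modelTangent_id]
      rfl
    have e3 : modelTangent E E (fun p => X.Φ (B₀ a) (B₁ p)⁻¹) =
        (X.linearization (B₀ a)).comp (-modelTangent E E B₁) := by
      rw [modelTangent_comp (X.mdifferentiableAt_act _) di (by simp [h₁]),
        modelTangent_inv d₁ h₁]
      rfl
    have f2 : MDifferentiableAt 𝓘(ℝ, E) 𝓘(ℝ, E) (fun p => X.Φ (a * B₀ a) (p * B₁ p)) 1 :=
      (X.mdifferentiableAt_act _).comp 1 dm
    have f3 : MDifferentiableAt 𝓘(ℝ, E) 𝓘(ℝ, E) (fun p => X.Φ (B₀ a) (B₁ p)⁻¹) 1 :=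
      (X.mdifferentiableAt_act _).comp 1 di
    have e4 := modelTangent_mul f2 f3 (by simp [h₁]) (by simp [h₁])
    have e5 := modelTangent_comp (g := B₁) d₁
      (((contMDiff_mul 𝓘(ℝ, E) ∞).mdifferentiable (by simp) _).comp (1 : H) (f2.prodMk f3))
      (by simp [h₁])
    have e6 := e1.symm.trans ((congrArg (modelTangent E E) (funext (hact a))).trans e5)
    have e7 := DFunLike.congr_fun (e6.trans
      (congrArg (modelTangent E E B₁).comp (e4.trans (congrArg₂ (· + ·) e2 e3)))) u
    simpa [sub_eq_add_neg] using e7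
  have g₀ := X.hasFDerivAtOne_linearization.comp_modelTangent d₀ h₀
  have dm₀ : MDifferentiableAt 𝓘(ℝ, F) 𝓘(ℝ, F) (fun a : G => a * B₀ a) 1 :=
    (contMDiff_id.mul hB₀).mdifferentiable (by simp) 1
  have gm := X.hasFDerivAtOne_linearization.comp_modelTangent dm₀ (by simp [h₀])
  have em : modelTangent F F (fun a : G => a * B₀ a) = .id ℝ F + modelTangent F F B₀ := by
    rw [modelTangent_mul (f := fun a => a) mdifferentiableAt_id d₀ rfl h₀, modelTangent_id]
  rw [em] at gm
  have k1 := g₀.clm_apply_const (modelTangent E E B₁ u)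
  have k2 := ((gm.clm_apply_const (u + modelTangent E E B₁ u)).sub k1).const_clm_apply
    (modelTangent E E B₁)
  rw [← funext hlin] at k2
  -- The argument of `B₁` is now `D(x + B₀x)(u + B₁u) - D(B₀x)(B₁u)`; one of its four products
  -- cancels.
  have k3 := DFunLike.congr_fun (k1.unique k2) x
  simp at k3
  rw [k3]
  simp only [map_add]
  abel

end LieGroupCrossedModule

/-! ### Rota-Baxter operators on a single group. -/

namespace IsLieGroupRotaBaxter

variable {F : Type*} [NormedAddCommGroup F] [NormedSpace ℝ F]
  {G : Type*} [TopologicalSpace G] [ChartedSpace F G] [Group G] [LieGroup 𝓘(ℝ, F) ∞ G] {B : G → G}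

theorem map_one (hB : IsLieGroupRotaBaxter F B) : B 1 = 1 := by
  have h := hB.mul_eq 1 1
  simpa using h

theorem conj_eq (hB : IsLieGroupRotaBaxter F B) (a b : G) :
    B a * B b * (B a)⁻¹ =
      B (a * B a * (b * B b) * (a * B a)⁻¹ * (B a * (B b)⁻¹ * (B a)⁻¹)) := by
  -- Chosen so that its product with `B a` is `B 1`. With `(B a)⁻¹` itself a value of `B`, the
  -- conjugate is a product of three such values and merges into one.
  have hinv : B ((B a)⁻¹ * a⁻¹ * B a) = (B a)⁻¹ := by
    refine eq_inv_of_mul_eq_one_right ?_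
    rw [hB.mul_eq, ← hB.map_one]
    congr 1
    group
  rw [← hinv, hB.mul_eq a b, hB.mul_eq, ← hB.mul_eq a b, hinv]
  congr 1
  group

theorem derivAction_conj (hB : IsLieGroupRotaBaxter F B) (x y : F) :
    (LieGroupCrossedModule.conj F G).derivAction (modelTangent F F B x) (modelTangent F F B y) =
      modelTangent F F B
        ((LieGroupCrossedModule.conj F G).derivAction (modelTangent F F B x) y +
          (LieGroupCrossedModule.conj F G).derivAction x (modelTangent F F B y) +
          (LieGroupCrossedModule.conj F G).derivAction x y) := by
  rw [(LieGroupCrossedModule.conj F G).derivAction_rotaBaxter hB.contMDiff hB.contMDiff hB.map_one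
    hB.map_one (fun a b => hB.conj_eq a b)]
  congr 2
  exact add_comm _ _

end IsLieGroupRotaBaxter

/-! ### Assembly of the crossed module of Lie algebras. -/

namespace LieGroupCrossedModule

variable {E F : Type*} [NormedAddCommGroup E] [NormedSpace ℝ E] [CompleteSpace E]
  [NormedAddCommGroup F] [NormedSpace ℝ F] [CompleteSpace F]
  {H : Type*} [TopologicalSpace H] [ChartedSpace E H] [Group H] [LieGroup 𝓘(ℝ, E) ∞ H]
  {G : Type*} [TopologicalSpace G] [ChartedSpace F G] [Group G] [LieGroup 𝓘(ℝ, F) ∞ G]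

/-- The homomorphism of Lie algebras of the homomorphism of Lie groups in a crossed module. -/
noncomputable def tangentLieHom (X : LieGroupCrossedModule E F H G) :
    GroupLieAlgebra 𝓘(ℝ, E) H →ₗ⁅ℝ⁆ GroupLieAlgebra 𝓘(ℝ, F) G :=
  { (tangentAtOne E F X.t).toLinearMap with
    map_lie' := fun {u v} => by
      simp only [bracket_eq]
      exact derivAction_conj_map X.contMDiff_t u v }

/-- The infinitesimal action of a crossed module of Lie groups, by derivations. -/
noncomputable def actionDerivation (X : LieGroupCrossedModule E F H G)
    (x : GroupLieAlgebra 𝓘(ℝ, F) G) :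
    LieDerivation ℝ (GroupLieAlgebra 𝓘(ℝ, E) H) (GroupLieAlgebra 𝓘(ℝ, E) H) where
  toFun := fun u => X.derivAction x u
  map_add' := fun u v => map_add (X.derivAction x) u v
  map_smul' := fun c u => map_smul (X.derivAction x) c u
  leibniz' := fun u v => by
    refine (congrArg (X.derivAction x) (bracket_eq u v)).trans ?_
    refine (X.derivAction_derivation x u v).trans ?_
    -- The field `leibniz'` has the form `⁅u, D v⁆ - ⁅v, D u⁆`.
    rw [← lie_skew v, sub_neg_eq_add, add_comm]
    simp only [bracket_eq]
    rfl

/-- The infinitesimal action of a crossed module of Lie groups, as a homomorphism of Lie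
algebras. -/
noncomputable def actionLieHom (X : LieGroupCrossedModule E F H G) :
    GroupLieAlgebra 𝓘(ℝ, F) G →ₗ⁅ℝ⁆
      LieDerivation ℝ (GroupLieAlgebra 𝓘(ℝ, E) H) (GroupLieAlgebra 𝓘(ℝ, E) H) where
  toFun := X.actionDerivation
  map_add' := fun x y => by
    ext u
    exact DFunLike.congr_fun (map_add X.derivAction x y) u
  map_smul' := fun c x => by
    ext u
    exact DFunLike.congr_fun (map_smul X.derivAction c x) u
  map_lie' := fun {x y} => by
    ext u
    refine Eq.trans ?_ (LieDerivation.lie_apply (X.actionDerivation x) (X.actionDerivation y) u).symm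
    exact (congrArg (fun z => X.derivAction z u) (bracket_eq x y)).trans
      (X.derivAction_derivAction_conj x y u)

/-- The crossed module of Lie algebras of a crossed module of Lie groups. -/
noncomputable def lieAlgCrossedModule (X : LieGroupCrossedModule E F H G) :
    LieAlgCrossedModule (GroupLieAlgebra 𝓘(ℝ, E) H) (GroupLieAlgebra 𝓘(ℝ, F) G) where
  t := X.tangentLieHom
  φ := X.actionLieHom
  map_act x u := (X.modelTangent_t_derivAction x u).trans (bracket_eq x (X.tangentLieHom u)).symm
  act_map u v := (X.derivAction_modelTangent_t u v).trans (bracket_eq u v).symm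

theorem isAssociated_lieAlgCrossedModule (X : LieGroupCrossedModule E F H G) :
    X.IsAssociated X.lieAlgCrossedModule where
  t_eq _ := rfl
  φ_eq x u := (X.infinitesimalAction_eq x u).symm

end LieGroupCrossedModule

theorem IsLieGroupRotaBaxter.isLieAlgRotaBaxter {F : Type*} [NormedAddCommGroup F]
    [NormedSpace ℝ F] [CompleteSpace F] {G : Type*} [TopologicalSpace G] [ChartedSpace F G]
    [Group G] [LieGroup 𝓘(ℝ, F) ∞ G] {B : G → G} (hB : IsLieGroupRotaBaxter F B) :
    IsLieAlgRotaBaxter (tangentAtOne F F B).toLinearMap := fun x y => by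
  simp only [LieGroupCrossedModule.bracket_eq]
  exact hB.derivAction_conj x y

theorem theoremd1 {E F : Type*} [NormedAddCommGroup E] [NormedSpace ℝ E] [CompleteSpace E]
    [NormedAddCommGroup F] [NormedSpace ℝ F] [CompleteSpace F]
    {H : Type*} [TopologicalSpace H] [ChartedSpace E H] [Group H] [LieGroup 𝓘(ℝ, E) ∞ H]
    {G : Type*} [TopologicalSpace G] [ChartedSpace F G] [Group G] [LieGroup 𝓘(ℝ, F) ∞ G]
    (X : LieGroupCrossedModule E F H G) (B₁ : H → H) (B₀ : G → G) (hB : X.IsRotaBaxter B₁ B₀) :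
    ∃ C : LieAlgCrossedModule (GroupLieAlgebra 𝓘(ℝ, E) H) (GroupLieAlgebra 𝓘(ℝ, F) G),
      X.IsAssociated C ∧
        C.IsRotaBaxter (tangentAtOne E E B₁).toLinearMap (tangentAtOne F F B₀).toLinearMap := by
  have h₁ := hB.rotaBaxter₁.map_one
  have h₀ := hB.rotaBaxter₀.map_one
  refine ⟨X.lieAlgCrossedModule, X.isAssociated_lieAlgCrossedModule,
    hB.rotaBaxter₁.isLieAlgRotaBaxter, hB.rotaBaxter₀.isLieAlgRotaBaxter, fun u => ?_, fun x u =>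
    X.derivAction_rotaBaxter hB.rotaBaxter₁.contMDiff hB.rotaBaxter₀.contMDiff h₁ h₀ hB.act_comm x u⟩
  have d₁ : MDifferentiableAt 𝓘(ℝ, E) 𝓘(ℝ, E) B₁ 1 :=
    hB.rotaBaxter₁.contMDiff.mdifferentiable (by simp) 1
  have d₀ : MDifferentiableAt 𝓘(ℝ, F) 𝓘(ℝ, F) B₀ 1 :=
    hB.rotaBaxter₀.contMDiff.mdifferentiable (by simp) 1
  -- Chain rule applied to both sides of `t ∘ B₁ = B₀ ∘ t`.
  have h := (modelTangent_comp X.mdifferentiableAt_t d₁ h₁).symm.trans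
    ((congrArg (modelTangent E F) (funext hB.map_comm)).trans
      (modelTangent_comp d₀ X.mdifferentiableAt_t (map_one X.t)))
  exact DFunLike.congr_fun h u
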